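/- All graphs are finite, simple and undirected, and $\log$ denotes the natural logarithm. For an integer $\ell\ge 1$, an $\ell$-vertex-ranking of a graph $G$ is a colouring of $V(G)$ with integers such that every connected subgraph $H$ of $G$ of diameter (measured in $H$) at most $\ell$ contains a vertex whose colour is larger than that of every other vertex of $H$. The $\ell$-vertex-ranking number $\mathrm{rn}_\ell(G)$ is the minimum integer $k$ such that $G$ has an $\ell$-vertex-ranking $\varphi:V(G)\to\{1,\ldots,k\}$. A graph $G$ is $d$-degenerate if for every non-empty $S\subseteq V(G)$ the induced subgraph $G[S]$ has a vertex of degree at most $d$. **Theorem.** For all integers $d\ge 1$ and $\ell\ge 2$ there exists a constant $c=c(d,\ell)>0$ such that, for every integer $\Delta\ge d$ and every integer $n\ge\max\{\Delta,2\}$, every $n$-vertex $d$-degenerate graph $G$ of maximum degree at most $\Delta$ satisfies \[ \mathrm{rn}_\ell(G)\le c\,\Delta^{\lfloor \ell/2\rfloor-1/2}\log^{5/4} n =\begin{cases} c\,\Delta^{\ell/2-1}\log^{5/4} n & \text{if $\ell$ is odd,}\\ c\,\Delta^{\ell/2-1/2}\log^{5/4} n & \text{if $\ell$ is even.}\end{cases}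 \] Furthermore, with the same constant $c$, if $\Delta^{\lfloor \ell/2\rfloor-1}\ge\log n$, then $\mathrm{rn}_\ell(G)\le c\,\Delta^{\lfloor \ell/2\rfloor-1/2}\log n$. -/

import Mathlib

namespace SimpleGraph

/-- A colouring `φ` of the vertices of `G` by natural numbers is an `ℓ`-vertex-ranking if every
connected subgraph `H` of `G` (not necessarily induced) whose diameter, measured in `H` itself,
is at most `ℓ` has a vertex whose colour is larger than that of every other vertex of `H`. -/
def IsVertexRanking {V : Type*} (G : SimpleGraph V) (ℓ : ℕ) (φ : V → ℕ) : Prop :=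
  ∀ H : G.Subgraph, H.Connected → H.coe.ediam ≤ (ℓ : ℕ∞) →
    ∃ v ∈ H.verts, ∀ w ∈ H.verts, w ≠ v → φ w < φ v

/-- The `ℓ`-vertex-ranking number: the least `k` such that `G` has an `ℓ`-vertex-ranking
with colours in `{1, …, k}`. -/
noncomputable def vertexRankingNumber {V : Type*} (G : SimpleGraph V) (ℓ : ℕ) : ℕ :=
  sInf {k : ℕ | ∃ φ : V → ℕ, (∀ v, φ v ∈ Set.Icc 1 k) ∧ G.IsVertexRanking ℓ φ}

/-- On a finite graph the set in the definition of `vertexRankingNumber` is nonempty,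
so that the minimum is attained. -/
theorem exists_isVertexRanking {V : Type*} [Fintype V] (G : SimpleGraph V) (ℓ : ℕ) :
    ∃ φ : V → ℕ, (∀ v, φ v ∈ Set.Icc 1 (G.vertexRankingNumber ℓ)) ∧ G.IsVertexRanking ℓ φ := by
  have hne : {k : ℕ | ∃ φ : V → ℕ, (∀ v, φ v ∈ Set.Icc 1 k) ∧
      G.IsVertexRanking ℓ φ}.Nonempty := by
    refine ⟨Fintype.card V, fun v => (Fintype.equivFin V v : ℕ) + 1, fun v => ?_, ?_⟩
    · exact ⟨Nat.succ_le_succ (Nat.zero_le _), (Fintype.equivFin V v).isLt⟩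
    · intro H hH _
      obtain ⟨v, hv, hmax⟩ := Set.exists_max_image H.verts
        (fun v => (Fintype.equivFin V v : ℕ) + 1) (Set.toFinite _) hH.nonempty
      refine ⟨v, hv, fun w hw hwv => lt_of_le_of_ne (hmax w hw) fun h => hwv ?_⟩
      exact (Fintype.equivFin V).injective (Fin.ext (Nat.succ_injective h))
  exact Nat.sInf_mem hne

/-- `G` is `d`-degenerate if, for every nonempty finite set `S` of vertices, the induced subgraph
`G[S]` has a vertex of degree at most `d`. -/
def IsDegenerate {V : Type*} (G : SimpleGraph V) (d : ℕ) : Prop :=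
  ∀ S : Finset V, S.Nonempty → ∃ v ∈ S, {w : V | w ∈ S ∧ G.Adj v w}.ncard ≤ d

end SimpleGraph

/-! Degeneracy yields O(log n) layers in which every vertex has at most 4d neighbours in its own or
higher layers. Hence only steps to a lower layer (descents) cost a factor Δ: walks of length at most
ℓ with at most i descents reach O(Δ^i) vertices (`card_descentReachable_le`). Since reversal turns
descents into ascents, every walk of length at most ℓ has a direction with at most ⌊ℓ/2⌋ descents.

Colour lexicographically by layer, then by one of k ≈ P = Δ^(⌊ℓ/2⌋ - 1/2) colours. A walk violates
the ranking only if its ends u, x share layer and colour and it never visits a higher layer. Charge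
it to the vertex v of its first descent: v reaches u with no descent and x with at most ⌊ℓ/2⌋ - 1.
Thus each v carries O(Δ^(⌊ℓ/2⌋ - 1)) pairs, and the O(Δ^⌊ℓ/2⌋) vertices v reachable from a fixed b
carry O(P²) triples. A random k-colouring would make O(P²/k) = O(P) of them monochromatic on
average; an exponential potential achieves O(P log n) for all b at once
(`exists_coloring_monochromatic_le`). The charged vertices are recoloured greedily with O(P log n)
new top colours, which destroys every violation. -/

namespace SimpleGraph

open Finset

/-! ### Peeling and derandomised colouring -/

/-- In a weighted digraph with all out-weights at most `s`, every nonempty set contains a vertex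
whose total in- and out-weight inside the set is at most `2 * s`. -/
theorem exists_weight_le {V : Type*} {W : V → V → ℝ} {s : ℝ} (A : Finset V)
    (hA : A.Nonempty) (hs : ∀ p, ∑ q ∈ A, W p q ≤ s) :
    ∃ p ∈ A, ∑ q ∈ A, (W p q + W q p) ≤ 2 * s := by
  apply Finset.exists_le_of_sum_le hA
  have h1 : ∑ p ∈ A, ∑ q ∈ A, (W p q + W q p) = 2 * ∑ p ∈ A, ∑ q ∈ A, W p q := by
    simp only [Finset.sum_add_distrib]
    rw [Finset.sum_comm (f := fun p q => W q p)]
    ring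
  rw [h1, ← Finset.mul_sum]
  have := Finset.sum_le_sum (s := A) fun p _ => hs p
  linarith

/-- A digraph with all out-degrees at most `s` is properly `(2 * s + 1)`-colourable. -/
theorem exists_coloring_of_outdegree_le {V : Type*} [Fintype V] [DecidableEq V]
    (f : V → Finset V) (s : ℕ) (hf : ∀ v, #(f v) ≤ s) :
    ∃ ψ : V → ℕ, (∀ v, ψ v ≤ 2 * s) ∧ ∀ u, ∀ v ∈ f u, u ≠ v → ψ u ≠ ψ v := by
  suffices H : ∀ A : Finset V, ∃ ψ : V → ℕ, (∀ v, ψ v ≤ 2 * s) ∧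
      ∀ u ∈ A, ∀ v ∈ A, v ∈ f u → u ≠ v → ψ u ≠ ψ v by
    obtain ⟨ψ, h1, h2⟩ := H univ
    exact ⟨ψ, h1, fun u v hv => h2 u (mem_univ _) v (mem_univ _) hv⟩
  intro A
  induction A using Finset.strongInduction with
  | H A ih =>
    rcases A.eq_empty_or_nonempty with rfl | hA
    · exact ⟨fun _ => 0, by simp, by simp⟩
    -- In-degrees may be large, but some `p` has at most `2 * s` in- and out-neighbours in `A`; it
    -- is coloured greedily after the rest.
    obtain ⟨p, hp, hpw⟩ := exists_weight_le (W := fun p q => if q ∈ f p then (1 : ℝ) else 0)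
      (s := s) A hA (fun p => by
        rw [Finset.sum_boole]
        exact_mod_cast (card_le_card (fun x hx => (mem_filter.1 hx).2)).trans (hf p))
    obtain ⟨ψ, h1, h2⟩ := ih _ (erase_ssubset hp)
    let N := (A.filter (· ∈ f p)) ∪ (A.filter (p ∈ f ·))
    have hN : #N ≤ 2 * s := by
      rw [Finset.sum_add_distrib, Finset.sum_boole, Finset.sum_boole] at hpw
      exact (card_union_le _ _).trans (by exact_mod_cast hpw)
    obtain ⟨x, hx, hxN⟩ : ∃ x ∈ range (2 * s + 1), x ∉ N.image ψ := by
      by_contra! h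
      have := (card_le_card (show range (2 * s + 1) ⊆ N.image ψ from h)).trans card_image_le
      rw [card_range] at this
      omega
    refine ⟨Function.update ψ p x, fun v => ?_, fun u hu v hv huv hne => ?_⟩
    · by_cases hv : v = p
      · subst hv; simp at hx ⊢; omega
      · simpa [hv] using h1 v
    · have key : ∀ w ∈ N, ψ w ≠ x := fun w hw h => hxN (mem_image.2 ⟨w, hw, h⟩)
      by_cases hup : u = p
      · subst hup
        rw [Function.update_self, Function.update_of_ne hne.symm]
        exact (key v (by simp [N, hv, huv])).symm
      · by_cases hvp : v = p
        · subst hvp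
          rw [Function.update_self, Function.update_of_ne hne]
          exact key u (by simp [N, hu, huv])
        · rw [Function.update_of_ne hup, Function.update_of_ne hvp]
          exact h2 u (by simp [hu, hup]) v (by simp [hv, hvp]) huv hne

/-- One step of the derandomized colouring: some colour `x` of bounded total weight `g x` does not
increase the sum of the exponential potentials. -/
theorem exists_color_step {B : Type*} [Fintype B] {k : ℕ} (hk : 0 < k) {S : ℝ} (hS : 0 < S)
    (g : Fin k → ℝ) (hg0 : ∀ x, 0 ≤ g x) (hg : ∑ x, g x ≤ 2 * S)
    (e : B → Fin k → ℝ) (he0 : ∀ b x, 0 ≤ e b x) (he : ∀ b x, e b x ≤ g x)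
    (E : B → ℝ) (T : B → ℝ) (hT : ∀ b, ∑ x, e b x ≤ T b) :
    ∃ x, ∑ b, Real.exp (E b + (e b x - 4 / k * T b) / (4 * S / k)) ≤ ∑ b, Real.exp (E b) := by
  have hk' : (0 : ℝ) < k := by exact_mod_cast hk
  set M : ℝ := 4 * S / k with hM
  have hMpos : 0 < M := by positivity
  -- By Markov's inequality at least half of the colours are allowed, that is, have `g x ≤ M`.
  set Al : Finset (Fin k) := univ.filter fun x => g x ≤ M with hAl
  have hbad : (#(univ.filter fun x => ¬ g x ≤ M) : ℝ) * M ≤ 2 * S := by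
    calc (#(univ.filter fun x => ¬ g x ≤ M) : ℝ) * M
        = ∑ x ∈ univ.filter (fun x => ¬ g x ≤ M), M := by simp
      _ ≤ ∑ x ∈ univ.filter (fun x => ¬ g x ≤ M), g x :=
        sum_le_sum fun x hx => (not_le.1 (mem_filter.1 hx).2).le
      _ ≤ ∑ x, g x := sum_le_sum_of_subset_of_nonneg (filter_subset _ _) fun x _ _ => hg0 x
      _ ≤ 2 * S := hg
  have hcard : (#Al : ℝ) + #(univ.filter fun x => ¬ g x ≤ M) = k := by
    have := card_filter_add_card_filter_not (s := (univ : Finset (Fin k))) (fun x => g x ≤ M)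
    rw [card_univ, Fintype.card_fin] at this
    exact_mod_cast this
  have hbad2 : (#(univ.filter fun x => ¬ g x ≤ M) : ℝ) ≤ k / 2 := by
    have : (k : ℝ) / 2 * M = 2 * S := by rw [hM]; field_simp; ring
    rw [← this] at hbad
    exact le_of_mul_le_mul_right hbad hMpos
  have hAlk : (k : ℝ) / 2 ≤ #Al := by linarith
  have hAlpos : (0 : ℝ) < #Al := by linarith [half_pos hk']
  have hAlne : Al.Nonempty := by
    rw [← card_pos]; exact_mod_cast hAlpos
  obtain ⟨x, -, hx⟩ := Finset.exists_le_of_sum_le (s := Al)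
    (f := fun x => ∑ b, Real.exp (E b + (e b x - 4 / k * T b) / M))
    (g := fun _ => ∑ b, Real.exp (E b)) hAlne (by
      rw [sum_comm, sum_const, nsmul_eq_mul, mul_sum]
      refine sum_le_sum fun b _ => ?_
      have hT0 : 0 ≤ T b := (sum_nonneg fun x _ => he0 b x).trans (hT b)
      -- On allowed colours `e b x / M` lies in [0, 1], where exp z ≤ 1 + 2z. The mean of `e b x`
      -- over them is at most `2 / k * T b`, since they number at least k/2. The two factors 2 give
      -- the compensator `4 / k * T b`.
      have h1 : ∑ x ∈ Al, Real.exp (e b x / M) ≤ #Al * Real.exp (4 / k * T b / M) := by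
        calc ∑ x ∈ Al, Real.exp (e b x / M) ≤ ∑ x ∈ Al, (1 + 2 * (e b x / M)) := by
              refine sum_le_sum fun x hx => ?_
              have h0 : 0 ≤ e b x / M := div_nonneg (he0 b x) hMpos.le
              have h1 : e b x / M ≤ 1 :=
                (div_le_one hMpos).2 ((he b x).trans (mem_filter.1 hx).2)
              have := Real.abs_exp_sub_one_sub_id_le (x := e b x / M) (by rwa [abs_of_nonneg h0])
              have := (abs_le.1 this).2
              nlinarith
          _ = #Al + 2 / M * ∑ x ∈ Al, e b x := by
              rw [sum_add_distrib, sum_const, nsmul_eq_mul, mul_one, mul_sum]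
              congr 1
              exact sum_congr rfl fun x _ => by ring
          _ ≤ #Al + 2 / M * T b := by
              gcongr
              exact (sum_le_sum_of_subset_of_nonneg (filter_subset _ _)
                fun x _ _ => he0 b x).trans (hT b)
          _ ≤ #Al + #Al * (4 / k * T b / M) := by
              have h2 : 2 / M * T b = k / 2 * (4 / k * T b / M) := by field_simp; ring
              have h3 : (k : ℝ) / 2 * (4 / k * T b / M) ≤ #Al * (4 / k * T b / M) := by gcongr
              linarith
          _ = #Al * (4 / k * T b / M + 1) := by ring
          _ ≤ _ := by gcongr; exact Real.add_one_le_exp _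
      calc ∑ x ∈ Al, Real.exp (E b + (e b x - 4 / k * T b) / M)
          = Real.exp (E b) * Real.exp (-(4 / k * T b / M)) * ∑ x ∈ Al, Real.exp (e b x / M) := by
            rw [mul_sum]
            refine sum_congr rfl fun x _ => ?_
            rw [← Real.exp_add, ← Real.exp_add]
            congr 1; ring
        _ ≤ Real.exp (E b) * Real.exp (-(4 / k * T b / M)) *
              (#Al * Real.exp (4 / k * T b / M)) := by gcongr
        _ = #Al * Real.exp (E b) * (Real.exp (-(4 / k * T b / M)) * Real.exp (4 / k * T b / M)) := by
            ring
        _ = _ := by rw [← Real.exp_add]; simp)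
  exact ⟨x, hx⟩

/-- Given families `w b` of weights dominated by `W`, whose out-weights are at most `S`, there is a
`k`-colouring for which every `w b` has a small weight of monochromatic pairs. -/
theorem exists_coloring_monochromatic_le {V B : Type*} [Fintype V] [DecidableEq V] [Fintype B]
    {k : ℕ} (hk : 0 < k) {S : ℝ} (hS : 0 < S) (W : V → V → ℝ)
    (hWd : ∀ p, W p p = 0) (hWS : ∀ p, ∑ q, W p q ≤ S) (w : B → V → V → ℝ)
    (hw0 : ∀ b p q, 0 ≤ w b p q) (hw : ∀ b p q, w b p q ≤ W p q) :
    ∃ c : V → Fin k, ∀ b, ∑ p, ∑ q, (if c p = c q then w b p q else 0) ≤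
      4 / k * ∑ p, ∑ q, w b p q + 4 * S / k * Real.log (Fintype.card B) := by
  have hk' : (0 : ℝ) < k := by exact_mod_cast hk
  have hW0 : ∀ p q, 0 ≤ W p q ∨ IsEmpty B := fun p q => by
    rcases isEmpty_or_nonempty B with h | ⟨⟨b⟩⟩
    · exact .inr h
    · exact .inl ((hw0 b p q).trans (hw b p q))
  rcases isEmpty_or_nonempty B with hB | hB
  · exact ⟨fun _ => ⟨0, hk⟩, fun b => hB.elim b⟩
  replace hW0 : ∀ p q, 0 ≤ W p q := fun p q => (hW0 p q).resolve_right (not_isEmpty_of_nonempty B)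
  have hwd : ∀ b p, w b p p = 0 := fun b p =>
    le_antisymm ((hw b p p).trans_eq (hWd p)) (hw0 b p p)
  -- The potential equals `Fintype.card B` for empty `A` and never increases. Every single term is
  -- then at most `Fintype.card B`, whence the logarithm.
  suffices H : ∀ A : Finset V, ∃ c : V → Fin k,
      ∑ b, Real.exp ((∑ p ∈ A, ∑ q ∈ A, (if c p = c q then w b p q else 0) -
        4 / k * ∑ p ∈ A, ∑ q ∈ A, w b p q) / (4 * S / k)) ≤ Fintype.card B by
    obtain ⟨c, hc⟩ := H univ
    refine ⟨c, fun b => ?_⟩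
    have h1 := (single_le_sum (f := fun b => Real.exp ((∑ p, ∑ q, (if c p = c q then w b p q else 0)
      - 4 / k * ∑ p, ∑ q, w b p q) / (4 * S / k))) (fun b _ => (Real.exp_pos _).le)
      (mem_univ b)).trans hc
    have h2 := (Real.le_log_iff_exp_le (by exact_mod_cast Fintype.card_pos)).2 h1
    rw [div_le_iff₀ (by positivity)] at h2
    linarith
  intro A
  induction A using Finset.strongInduction with
  | H A ih =>
    rcases A.eq_empty_or_nonempty with rfl | hA
    · exact ⟨fun _ => ⟨0, hk⟩, by simp⟩
    -- Peeling a vertex of total weight at most 2S and colouring it last makes the out-weight bound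
    -- sufficient.
    obtain ⟨p, hp, hpw⟩ := exists_weight_le (W := W) (s := S) A hA (fun p =>
      (sum_le_sum_of_subset_of_nonneg (subset_univ _) fun q _ _ => hW0 p q).trans (hWS p))
    obtain ⟨c, hc⟩ := ih _ (erase_ssubset hp)
    set A' := A.erase p with hA'
    have hpA' : p ∉ A' := notMem_erase _ _
    have hAA' : A = insert p A' := (insert_erase hp).symm
    have hsplit : ∀ F : V → V → ℝ, F p p = 0 → ∑ a ∈ A, ∑ q ∈ A, F a q =
        ∑ a ∈ A', ∑ q ∈ A', F a q + ∑ q ∈ A', (F p q + F q p) := by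
      intro F hF
      simp only [hAA', sum_insert hpA', sum_add_distrib, hF]
      ring
    have hfib : ∀ F : V → ℝ, ∑ x, ∑ q ∈ A', (if c q = x then F q else 0) = ∑ q ∈ A', F q := by
      intro F
      rw [sum_comm]
      simp
    obtain ⟨x, hx⟩ := exists_color_step hk hS
      (fun x => ∑ q ∈ A', (if c q = x then W p q + W q p else 0))
      (fun x => sum_nonneg fun q _ => by split_ifs; exacts [add_nonneg (hW0 _ _) (hW0 _ _), le_rfl])
      (by
        rw [hfib]
        exact (sum_le_sum_of_subset_of_nonneg (erase_subset _ _)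
          fun q _ _ => add_nonneg (hW0 _ _) (hW0 _ _)).trans hpw)
      (fun b x => ∑ q ∈ A', (if c q = x then w b p q + w b q p else 0))
      (fun b x => sum_nonneg fun q _ => by
        split_ifs; exacts [add_nonneg (hw0 _ _ _) (hw0 _ _ _), le_rfl])
      (fun b x => sum_le_sum fun q _ => by
        split_ifs; exacts [add_le_add (hw _ _ _) (hw _ _ _), le_rfl])
      (fun b => (∑ p ∈ A', ∑ q ∈ A', (if c p = c q then w b p q else 0) -
        4 / k * ∑ p ∈ A', ∑ q ∈ A', w b p q) / (4 * S / k))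
      (fun b => ∑ q ∈ A', (w b p q + w b q p)) (fun b => (hfib _).le)
    refine ⟨Function.update c p x, le_trans (le_of_eq (sum_congr rfl fun b _ => ?_)) (hx.trans hc)⟩
    have hne : ∀ q ∈ A', q ≠ p := fun q hq h => hpA' (h ▸ hq)
    rw [hsplit (w b) (hwd b p), hsplit (fun a q => if Function.update c p x a =
      Function.update c p x q then w b a q else 0) (by simp [hwd])]
    have e1 : ∑ a ∈ A', ∑ q ∈ A', (if Function.update c p x a = Function.update c p x q
        then w b a q else 0) = ∑ a ∈ A', ∑ q ∈ A', (if c a = c q then w b a q else 0) :=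
      sum_congr rfl fun a ha => sum_congr rfl fun q hq => by
        rw [Function.update_of_ne (hne a ha), Function.update_of_ne (hne q hq)]
    have e2 : ∑ q ∈ A', ((if Function.update c p x p = Function.update c p x q then w b p q else 0)
        + (if Function.update c p x q = Function.update c p x p then w b q p else 0)) =
        ∑ q ∈ A', (if c q = x then w b p q + w b q p else 0) :=
      sum_congr rfl fun q hq => by
        rw [Function.update_self, Function.update_of_ne (hne q hq)]
        by_cases h : c q = x
        · simp [h]
        · simp [h, Ne.symm h]
    rw [e1, e2, ← add_div]
    congr 2
    ring

/-! ### Layerings of degenerate graphs -/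

section Layering

variable {V : Type*} {G : SimpleGraph V}

open Classical in
-- Deleting a vertex of degree at most `d` removes at most `d` edges, each counted twice in the
-- degree sum.
theorem IsDegenerate.sum_degree_le {d : ℕ} (h : G.IsDegenerate d) (S : Finset V) :
    ∑ v ∈ S, #{w ∈ S | G.Adj v w} ≤ 2 * d * #S := by
  induction S using Finset.strongInduction with
  | H S ih =>
    rcases S.eq_empty_or_nonempty with rfl | hS
    · simp
    obtain ⟨v, hv, hdeg⟩ := h S hS
    have hdeg' : #{w ∈ S | G.Adj v w} ≤ d := by
      rw [← Set.ncard_coe_finset]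
      convert hdeg using 2
      ext w; simp
    have ih' := ih _ (erase_ssubset hv)
    have hcard := card_erase_add_one hv
    set S' := S.erase v with hS'
    have hvS' : v ∉ S' := notMem_erase _ _
    have hSS' : S = insert v S' := (insert_erase hv).symm
    have h1 : ∀ u ∈ S', #{w ∈ S | G.Adj u w} =
        #{w ∈ S' | G.Adj u w} + if G.Adj v u then 1 else 0 := by
      intro u _
      rw [hSS', filter_insert]
      by_cases huv : G.Adj u v
      · rw [if_pos huv, if_pos huv.symm, card_insert_of_notMem (by simp [hvS'])]
      · rw [if_neg huv, if_neg (fun h => huv h.symm), add_zero]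
    have h2 : ∑ u ∈ S', (if G.Adj v u then 1 else 0) = #{w ∈ S' | G.Adj v w} := by
      rw [card_filter]
    have h3 : #{w ∈ S | G.Adj v w} = #{w ∈ S' | G.Adj v w} := by
      rw [hSS', filter_insert, if_neg (G.loopless.irrefl v)]
    have h4 : ∑ u ∈ S, #{w ∈ S | G.Adj u w} =
        #{w ∈ S | G.Adj v w} + ∑ u ∈ S', #{w ∈ S | G.Adj u w} := by
      conv_lhs => rw [hSS', sum_insert hvS', ← hSS']
    rw [h4, sum_congr rfl h1, sum_add_distrib, h2, ← hcard]
    nlinarith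

open Classical in
/-- The vertices of a degenerate graph can be split into logarithmically many layers such that
each vertex has boundedly many neighbours in its own and higher layers. -/
theorem IsDegenerate.exists_layering [Fintype V] {d : ℕ} (h : G.IsDegenerate d) :
    ∃ L : V → ℕ, (∀ v, 2 ^ L v ≤ Fintype.card V) ∧
      ∀ v, #{w | G.Adj v w ∧ L v ≤ L w} ≤ 4 * d := by
  suffices H : ∀ S : Finset V, ∃ L : V → ℕ, ∀ v ∈ S, 2 ^ L v ≤ #S ∧
      #{w ∈ S | G.Adj v w ∧ L v ≤ L w} ≤ 4 * d by
    obtain ⟨L, hL⟩ := H univ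
    exact ⟨L, fun v => (hL v (mem_univ v)).1, fun v => (hL v (mem_univ v)).2⟩
  intro S
  induction S using Finset.strongInduction with
  | H S ih =>
    rcases S.eq_empty_or_nonempty with rfl | hS
    · exact ⟨fun _ => 0, by simp⟩
    -- The average degree in `S` is at most `2 * d`, so at most half of the vertices have degree
    -- above `4 * d`. The others form layer 0 and the recursion runs on `S'`.
    set S' := {v ∈ S | 4 * d < #{w ∈ S | G.Adj v w}} with hS'
    have hsum : #S' * (4 * d + 1) ≤ 2 * d * #S := by
      calc #S' * (4 * d + 1) ≤ ∑ v ∈ S', #{w ∈ S | G.Adj v w} := by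
            rw [← smul_eq_mul, ← sum_const]
            exact sum_le_sum fun v hv => (mem_filter.1 hv).2
        _ ≤ ∑ v ∈ S, #{w ∈ S | G.Adj v w} :=
            sum_le_sum_of_subset (filter_subset _ _)
        _ ≤ _ := h.sum_degree_le S
    have hhalf : 2 * #S' ≤ #S := by
      rcases Nat.eq_zero_or_pos d with rfl | hd
      · simp at hsum
        simp [hsum]
      · by_contra! hlt
        nlinarith
    have hpos := hS.card_pos
    have hss : S' ⊂ S := by
      refine (filter_subset _ _).ssubset_of_ne fun he => ?_
      rw [← hS'] at he
      rw [he] at hhalf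
      omega
    obtain ⟨L, hL⟩ := ih S' hss
    refine ⟨fun v => if v ∈ S' then L v + 1 else 0, fun v hv => ?_⟩
    by_cases hv' : v ∈ S'
    · obtain ⟨h1, h2⟩ := hL v hv'
      simp only [hv', if_true]
      refine ⟨by rw [pow_succ]; omega, le_trans (card_le_card fun w hw => ?_) h2⟩
      obtain ⟨hwS, hvw, hle⟩ := mem_filter.1 hw
      by_cases hw' : w ∈ S'
      · simp only [hw', if_true] at hle
        exact mem_filter.2 ⟨hw', hvw, by omega⟩
      · simp [hw'] at hle
    · simp only [hv', if_false]
      refine ⟨by simpa using hpos, le_trans (card_le_card fun w hw => ?_)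
        (not_lt.1 fun h => hv' (mem_filter.2 ⟨hv, h⟩))⟩
      exact mem_filter.2 ⟨(mem_filter.1 hw).1, (mem_filter.1 hw).2.1⟩

end Layering

/-! ### Walks with few descents -/

section Descents

variable {V : Type*} {G : SimpleGraph V} (L : V → ℕ)

/-- The number of steps of a walk that go to a strictly lower layer. -/
def Walk.descents : ∀ {u v : V}, G.Walk u v → ℕ
  | _, _, .nil => 0
  | u, _, .cons (v := w) _ p => (if L w < L u then 1 else 0) + p.descents

theorem Walk.descents_append {u v w : V} (p : G.Walk u v) (q : G.Walk v w) :
    (p.append q).descents L = p.descents L + q.descents L := by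
  induction p with
  | nil => simp [Walk.descents]
  | cons h p ih => simp [Walk.descents, ih, add_assoc]

/-- A step and its reversal cannot both descend. Consequently one direction of any walk descends in
at most half of its steps. -/
theorem Walk.descents_add_descents_reverse_le {u v : V} (p : G.Walk u v) :
    p.descents L + p.reverse.descents L ≤ p.length := by
  induction p with
  | nil => simp [Walk.descents]
  | cons h p ih =>
    simp only [Walk.reverse_cons, Walk.descents_append, Walk.descents, Walk.length_cons]
    split_ifs <;> omega

/-- `x` can be reached from `u` by a walk of length at most `m` with at most `i` descents. -/
def DescentReachable (G : SimpleGraph V) (m i : ℕ) (u x : V) : Prop :=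
  ∃ p : G.Walk u x, p.length ≤ m ∧ p.descents L ≤ i

variable {L}

theorem DescentReachable.mono {m m' i i' : ℕ} {u x : V} (h : G.DescentReachable L m i u x)
    (hm : m ≤ m') (hi : i ≤ i') : G.DescentReachable L m' i' u x :=
  let ⟨p, h1, h2⟩ := h
  ⟨p, h1.trans hm, h2.trans hi⟩

open Classical in
-- Split by the first step: the walk is trivial, takes one of at most `D` non-descending steps, or
-- takes one of at most `Δ` descents and spends one unit of `i`. These account for 1 + D + 1 = D +
-- 2.
theorem card_descentReachable_le [Fintype V] {D Δ : ℕ} (hΔ : 1 ≤ Δ)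
    (hD : ∀ v, #{w | G.Adj v w ∧ L v ≤ L w} ≤ D) (hdeg : ∀ v, #{w | G.Adj v w} ≤ Δ)
    (m i : ℕ) (u : V) : #{x | G.DescentReachable L m i u x} ≤ (D + 2) ^ m * Δ ^ i := by
  induction m generalizing i u with
  | zero =>
    calc #{x | G.DescentReachable L 0 i u x} ≤ #{u} := by
          refine card_le_card fun x hx => ?_
          obtain ⟨p, hp, -⟩ := (mem_filter.1 hx).2
          exact mem_singleton.2 (Walk.eq_of_length_eq_zero (Nat.le_zero.1 hp)).symm
      _ ≤ _ := by simpa using Nat.one_le_pow _ _ hΔ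
  | succ m ih =>
    have hup : #((univ.filter fun w => G.Adj u w ∧ L u ≤ L w).biUnion fun w =>
        {x | G.DescentReachable L m i w x}) ≤ D * ((D + 2) ^ m * Δ ^ i) :=
      (card_biUnion_le_card_mul _ _ _ fun w _ => ih i w).trans (Nat.mul_le_mul_right _ (hD u))
    have hone : 1 ≤ (D + 2) ^ m * Δ ^ i :=
      Nat.mul_pos (by positivity) (Nat.one_le_pow _ _ hΔ)
    cases i with
    | zero =>
      calc #{x | G.DescentReachable L (m + 1) 0 u x}
          ≤ #({u} ∪ (univ.filter fun w => G.Adj u w ∧ L u ≤ L w).biUnion fun w =>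
              {x | G.DescentReachable L m 0 w x}) := by
            refine card_le_card fun x hx => ?_
            obtain ⟨p, hp, hd⟩ := (mem_filter.1 hx).2
            cases p with
            | nil => simp
            | cons hadj p =>
              rename_i w
              simp only [Walk.descents, Walk.length_cons] at hp hd
              have hlt : ¬ L w < L u := fun h => by simp [h] at hd
              refine mem_union_right _ (mem_biUnion.2 ⟨w, ?_, ?_⟩)
              · simp [hadj, not_lt.1 hlt]
              · exact mem_filter.2 ⟨mem_univ _, p, by omega, by omega⟩
        _ ≤ 1 + D * ((D + 2) ^ m * Δ ^ 0) := (card_union_le _ _).trans (by simpa using hup)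
        _ ≤ _ := by rw [pow_succ]; nlinarith
    | succ i =>
      have hdown : #((univ.filter fun w => G.Adj u w).biUnion fun w =>
          {x | G.DescentReachable L m i w x}) ≤ Δ * ((D + 2) ^ m * Δ ^ i) :=
        (card_biUnion_le_card_mul _ _ _ fun w _ => ih i w).trans (Nat.mul_le_mul_right _ (hdeg u))
      calc #{x | G.DescentReachable L (m + 1) (i + 1) u x}
          ≤ #(({u} ∪ (univ.filter fun w => G.Adj u w ∧ L u ≤ L w).biUnion fun w =>
              {x | G.DescentReachable L m (i + 1) w x}) ∪
              (univ.filter fun w => G.Adj u w).biUnion fun w =>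
              {x | G.DescentReachable L m i w x}) := by
            refine card_le_card fun x hx => ?_
            obtain ⟨p, hp, hd⟩ := (mem_filter.1 hx).2
            cases p with
            | nil => simp
            | cons hadj p =>
              rename_i w
              simp only [Walk.descents, Walk.length_cons] at hp hd
              by_cases hlt : L w < L u
              · rw [if_pos hlt] at hd
                refine mem_union_right _ (mem_biUnion.2 ⟨w, by simp [hadj], ?_⟩)
                exact mem_filter.2 ⟨mem_univ _, p, by omega, by omega⟩
              · refine mem_union_left _ (mem_union_right _ (mem_biUnion.2 ⟨w, ?_, ?_⟩))
                · simp [hadj, not_lt.1 hlt]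
                · exact mem_filter.2 ⟨mem_univ _, p, by omega, by omega⟩
        _ ≤ (1 + D * ((D + 2) ^ m * Δ ^ (i + 1))) + Δ * ((D + 2) ^ m * Δ ^ i) :=
            (card_union_le _ _).trans (add_le_add ((card_union_le _ _).trans
              (by simpa using hup)) hdown)
        _ ≤ _ := by
            have e : Δ * ((D + 2) ^ m * Δ ^ i) = (D + 2) ^ m * Δ ^ (i + 1) := by ring
            rw [e, pow_succ (D + 2) m]
            nlinarith

/-- A walk between two vertices of the same layer that does not visit higher layers either stays
in that layer or has a vertex at which it descends for the first time. -/
theorem Walk.exists_first_descent {u x : V} (p : G.Walk u x) (hL : ∀ y ∈ p.support, L y ≤ L u)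
    {m h : ℕ} (hm : p.length ≤ m) (hd : p.descents L ≤ h) :
    ∃ v ∈ p.support, G.DescentReachable L m 0 v u ∧ G.DescentReachable L m 1 u v ∧
      G.DescentReachable L m (h - 1) v x := by
  induction p generalizing m with
  | nil => exact ⟨_, by simp, ⟨.nil, by simp, by simp [Walk.descents]⟩,
      ⟨.nil, by simp, by simp [Walk.descents]⟩, ⟨.nil, by simp, by simp [Walk.descents]⟩⟩
  | @cons u w x hadj p ih =>
    simp only [Walk.descents, Walk.length_cons] at hm hd
    have hwu : L w ≤ L u := hL w (by simp)
    by_cases hlt : L w < L u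
    · rw [if_pos hlt] at hd
      -- The reversal of a descent is an ascent, so returning from `w` to `u` costs no descent.
      refine ⟨w, by simp, ⟨.cons hadj.symm .nil, ?_, ?_⟩, ⟨.cons hadj .nil, ?_, ?_⟩,
        ⟨p, by omega, by omega⟩⟩
      · simp; omega
      · simp [Walk.descents, hwu]
      · simp; omega
      · simp [Walk.descents, hlt]
    · rw [if_neg hlt] at hd
      -- Before the first descent the walk stays in its layer, so these edges are free in both
      -- directions.
      have heq : L w = L u := le_antisymm hwu (not_lt.1 hlt)
      obtain ⟨v, hv, ⟨q₁, h1, h1'⟩, ⟨q₂, h2, h2'⟩, h3⟩ :=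
        ih (m := m - 1) (fun y hy => by rw [heq]; exact hL y (by simp [hy])) (by omega)
          (by omega)
      refine ⟨v, by simp [hv], ⟨q₁.append (.cons hadj.symm .nil), ?_, ?_⟩,
        ⟨.cons hadj q₂, ?_, ?_⟩, h3.mono (by omega) le_rfl⟩
      · simp; omega
      · simp [Walk.descents_append, Walk.descents, heq]; omega
      · simp; omega
      · simp [Walk.descents, heq]; omega

end Descents

/-! ### From layerings to vertex rankings -/

section Ranking

variable {V : Type*} {G : SimpleGraph V}

/-- A tie for the maximum colour of `H` would be joined by a shortest path of `H`, of length at most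
`ℓ`, on which no colour exceeds the maximum. -/
theorem isVertexRanking_of_walks [Finite V] {ℓ : ℕ} {φ : V → ℕ}
    (h : ∀ u x, u ≠ x → φ u = φ x → ∀ p : G.Walk u x, p.length ≤ ℓ →
      ∃ y ∈ p.support, φ u < φ y) : G.IsVertexRanking ℓ φ := by
  intro H hH hdiam
  obtain ⟨v, hv, hmax⟩ := Set.exists_max_image H.verts φ (Set.toFinite _) hH.nonempty
  refine ⟨v, hv, fun w hw hwv => lt_of_le_of_ne (hmax w hw) fun heq => ?_⟩
  have hconn : H.coe.Connected := hH.coe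
  obtain ⟨p, hp⟩ := hconn.exists_walk_length_eq_edist ⟨v, hv⟩ ⟨w, hw⟩
  have hlen : p.length ≤ ℓ := by
    have := hp.le.trans (SimpleGraph.edist_le_ediam.trans hdiam)
    exact_mod_cast this
  obtain ⟨y, hy, hlt⟩ := h (H.hom ⟨v, hv⟩) (H.hom ⟨w, hw⟩) hwv.symm heq.symm
    (p.map H.hom) (by rwa [Walk.length_map])
  rw [Walk.support_map] at hy
  obtain ⟨z, -, rfl⟩ := List.mem_map.1 hy
  exact absurd (hmax z.1 z.2) (not_le.2 hlt)

end Ranking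

open Classical in
/-- From a layering with few neighbours in higher layers one obtains a vertex ranking: colour
lexicographically by layer and by one of `k` colours, and recolour with the largest colours the
vertices at which this fails. -/
theorem vertexRankingNumber_le_of_layering {V : Type*} [Fintype V] {G : SimpleGraph V}
    {L : V → ℕ} {D Δ ℓ t k s : ℕ} (hΔ : 1 ≤ Δ) (hℓ : 2 ≤ ℓ) (hk : 0 < k) (ht : ∀ v, L v < t)
    (hD : ∀ v, #{w | G.Adj v w ∧ L v ≤ L w} ≤ D) (hdeg : ∀ v, #{w | G.Adj v w} ≤ Δ)
    (hs : 4 / k * ((((D + 2) ^ ℓ) ^ 3 * Δ ^ (2 * (ℓ / 2) - 1) : ℕ) : ℝ) +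
      4 * ((((D + 2) ^ ℓ) ^ 2 * Δ ^ (ℓ / 2) : ℕ) : ℝ) / k * Real.log (Fintype.card V) < s + 1) :
    G.vertexRankingNumber ℓ ≤ t * k + 2 * s + 1 := by
  have hh : 1 ≤ ℓ / 2 := by omega
  obtain ⟨h, hh'⟩ : ∃ h, h + 1 = ℓ / 2 := ⟨ℓ / 2 - 1, by omega⟩
  set C := (D + 2) ^ ℓ with hC
  have hCpos : 0 < C := by positivity
  set R : ℕ → V → Finset V := fun i u => {x | G.DescentReachable L ℓ i u x} with hR
  have hRcard : ∀ i u, #(R i u) ≤ C * Δ ^ i := card_descentReachable_le hΔ hD hdeg ℓ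
  -- The trace left by a walk from `p` to `q` at its first descent `v`. Having both `p ∈ R 0 v` and
  -- `v ∈ R 1 p` allows counting triples from `v` as well as from `p`.
  let Tr : V → V → V → Prop := fun v p q => p ≠ q ∧ p ∈ R 0 v ∧ v ∈ R 1 p ∧ q ∈ R h v
  -- the number of triples through a fixed first endpoint, and with a fixed middle vertex
  have hTr1 : ∀ p, #{x : V × V | Tr x.2 p x.1} ≤ C ^ 2 * Δ ^ (h + 1) := by
    intro p
    calc #{x : V × V | Tr x.2 p x.1}
        ≤ #((R 1 p).biUnion fun v => (R h v).image fun q => (q, v)) := by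
          refine card_le_card fun x hx => ?_
          obtain ⟨-, -, h1, h2⟩ := (mem_filter.1 hx).2
          exact mem_biUnion.2 ⟨x.2, h1, mem_image.2 ⟨x.1, h2, rfl⟩⟩
      _ ≤ C * Δ ^ 1 * (C * Δ ^ h) :=
          (card_biUnion_le_card_mul _ _ _ fun v _ => card_image_le.trans (hRcard h v)).trans
            (Nat.mul_le_mul_right _ (hRcard 1 p))
      _ = _ := by ring
  have hTr2 : ∀ v, #{x : V × V | Tr v x.1 x.2} ≤ C ^ 2 * Δ ^ h := by
    intro v
    calc #{x : V × V | Tr v x.1 x.2} ≤ #(R 0 v ×ˢ R h v) := by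
          refine card_le_card fun x hx => ?_
          obtain ⟨-, h1, -, h2⟩ := (mem_filter.1 hx).2
          exact mem_product.2 ⟨h1, h2⟩
      _ ≤ C * Δ ^ 0 * (C * Δ ^ h) := by
          rw [card_product]
          exact Nat.mul_le_mul (hRcard 0 v) (hRcard h v)
      _ = _ := by ring
  -- The weight of `(p, q)` is the number of possible middle vertices. There is one test family per
  -- `b`, restricted to middle vertices in `R (h + 1) b`.
  obtain ⟨c, hc⟩ := exists_coloring_monochromatic_le (V := V) (B := V) hk
    (S := ((C ^ 2 * Δ ^ (h + 1) : ℕ) : ℝ)) (by exact_mod_cast by positivity)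
    (fun p q => (#{v | Tr v p q} : ℝ))
    (fun p => by simp [Tr])
    (fun p => by
      rw [← Nat.cast_sum]
      refine Nat.cast_le.2 (le_trans (le_of_eq ?_) (hTr1 p))
      simp only [card_filter]
      rw [← univ_product_univ, sum_product])
    (fun b p q => (#{v ∈ R (h + 1) b | Tr v p q} : ℝ))
    (fun b p q => Nat.cast_nonneg _)
    (fun b p q => Nat.cast_le.2 (card_le_card (filter_subset_filter _ (subset_univ _))))
  let bad : V → Prop := fun v => ∃ p q, Tr v p q ∧ c p = c q
  have hbad : ∀ b, #{v ∈ R (h + 1) b | bad v} ≤ s := by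
    intro b
    have h1 : #{v ∈ R (h + 1) b | bad v} ≤
        ∑ p, ∑ q, if c p = c q then #{v ∈ R (h + 1) b | Tr v p q} else 0 := by
      calc #{v ∈ R (h + 1) b | bad v}
          ≤ #((univ : Finset V).biUnion fun p => (univ : Finset V).biUnion fun q =>
              if c p = c q then {v ∈ R (h + 1) b | Tr v p q} else ∅) := by
            refine card_le_card fun v hv => ?_
            obtain ⟨hvR, p, q, hT, hpq⟩ := mem_filter.1 hv
            refine mem_biUnion.2 ⟨p, mem_univ _, mem_biUnion.2 ⟨q, mem_univ _, ?_⟩⟩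
            rw [if_pos hpq]
            exact mem_filter.2 ⟨hvR, hT⟩
        _ ≤ _ := card_biUnion_le.trans (sum_le_sum fun p _ => card_biUnion_le.trans
            (sum_le_sum fun q _ => by split_ifs <;> simp))
    have h2 : ∑ p, ∑ q, #{v ∈ R (h + 1) b | Tr v p q} ≤ C ^ 3 * Δ ^ (2 * (ℓ / 2) - 1) := by
      calc ∑ p, ∑ q, #{v ∈ R (h + 1) b | Tr v p q}
          = ∑ v ∈ R (h + 1) b, #{x : V × V | Tr v x.1 x.2} := by
            simp only [card_filter, Fintype.sum_prod_type]
            exact (sum_congr rfl fun p _ => sum_comm).trans sum_comm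
        _ ≤ #(R (h + 1) b) * (C ^ 2 * Δ ^ h) := by
            rw [← smul_eq_mul]
            exact sum_le_card_nsmul _ _ _ fun v _ => hTr2 v
        _ ≤ C * Δ ^ (h + 1) * (C ^ 2 * Δ ^ h) := Nat.mul_le_mul_right _ (hRcard _ _)
        _ = _ := by
            rw [show 2 * (ℓ / 2) - 1 = h + 1 + h by omega]
            ring
    have h3 := hc b
    have h4 : (#{v ∈ R (h + 1) b | bad v} : ℝ) ≤
        ∑ p, ∑ q, (if c p = c q then (#{v ∈ R (h + 1) b | Tr v p q} : ℝ) else 0) := by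
      exact_mod_cast h1
    have h5 : ∑ p, ∑ q, (#{v ∈ R (h + 1) b | Tr v p q} : ℝ) ≤
        ((C ^ 3 * Δ ^ (2 * (ℓ / 2) - 1) : ℕ) : ℝ) := by
      exact_mod_cast h2
    rw [← hh'] at hs h5
    have h6 := mul_le_mul_of_nonneg_left h5 (show (0 : ℝ) ≤ 4 / k by positivity)
    have h7 : (#{v ∈ R (h + 1) b | bad v} : ℝ) < s + 1 := by linarith
    exact Nat.lt_succ_iff.1 (by exact_mod_cast h7)
  obtain ⟨ψ, hψs, hψ⟩ := exists_coloring_of_outdegree_le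
    (fun b => {v ∈ R (h + 1) b | bad v}) s hbad
  -- Ordinary colours end at `t * k`; as `ψ` takes values in 0, …, 2s, the recoloured vertices use
  -- the next `2 * s + 1` colours.
  let φ : V → ℕ := fun v => if bad v then t * k + 1 + ψ v else L v * k + c v + 1
  have hφ : ∀ v, ¬ bad v → φ v ≤ t * k := by
    intro v hv
    have h1 := (c v).isLt
    have h2 := Nat.mul_le_mul_right k (Nat.succ_le_of_lt (ht v))
    simp only [φ, if_neg hv]
    rw [Nat.succ_mul] at h2
    omega
  have hφbad : ∀ v, bad v → φ v = t * k + 1 + ψ v := fun v hv => if_pos hv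
  have hφL : ∀ u v, ¬ bad u → ¬ bad v → φ v ≤ φ u → L v ≤ L u := by
    intro u v hu hv huv
    simp only [φ, if_neg hu, if_neg hv] at huv
    by_contra! hlt
    have h1 := Nat.mul_le_mul_right k (Nat.succ_le_of_lt hlt)
    have h2 := (c u).isLt
    rw [Nat.succ_mul] at h1
    omega
  refine Nat.sInf_le ⟨φ, fun v => ?_, ?_⟩
  · by_cases hv : bad v
    · rw [hφbad v hv]
      have := hψs v
      constructor <;> omega
    · refine ⟨?_, (hφ v hv).trans (by omega)⟩
      simp only [φ, if_neg hv]
      omega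
  -- one of the two directions of a walk has at most half of its steps descending
  suffices H : ∀ u x, u ≠ x → φ u = φ x → ∀ p : G.Walk u x, p.length ≤ ℓ →
      p.descents L ≤ h + 1 → ∃ y ∈ p.support, φ u < φ y by
    refine isVertexRanking_of_walks fun u x hux hφux p hp => ?_
    rcases le_or_gt (p.descents L) (h + 1) with hd | hd
    · exact H u x hux hφux p hp hd
    · have := p.descents_add_descents_reverse_le L
      obtain ⟨y, hy, hlt⟩ := H x u hux.symm hφux.symm p.reverse (by simpa using hp) (by omega)
      exact ⟨y, by simpa using hy, hφux ▸ hlt⟩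
  intro u x hux hφux p hp hd
  by_contra! hall
  by_cases hu : bad u
  · have hx : bad x := by
      by_contra hx
      have := hφ x hx
      rw [← hφux, hφbad u hu] at this
      omega
    -- The walk has at most `h + 1` descents, so `x` is a bad vertex of `R (h + 1) u` and `ψ`
    -- separates it from `u`.
    refine hψ u x (mem_filter.2 ⟨mem_filter.2 ⟨mem_univ _, p, hp, hd⟩, hx⟩) hux ?_
    rw [hφbad u hu, hφbad x hx] at hφux
    omega
  · have hgood : ∀ y ∈ p.support, ¬ bad y := by
      intro y hy hby
      have h1 := hall y hy
      have h2 := hφ u hu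
      rw [hφbad y hby] at h1
      omega
    have hx := hgood x p.end_mem_support
    -- The first-descent vertex `v` lies on the walk, and equal colours of `u` and `x` would make it
    -- bad.
    obtain ⟨v, hv, h1, h2, h3⟩ := p.exists_first_descent (L := L)
      (fun y hy => hφL u y hu (hgood y hy) (hall y hy)) hp hd
    refine hgood v hv ⟨u, x, ⟨hux, by simpa [hR] using h1, by simpa [hR] using h2,
      by simpa [hR] using h3⟩, ?_⟩
    have hLux : L u = L x :=
      le_antisymm (hφL x u hx hu hφux.le) (hφL u x hu hx hφux.ge)
    simp only [φ, if_neg hu, if_neg hx, hLux] at hφux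
    exact Fin.ext (by omega)

end SimpleGraph

/-! ### Choice of parameters and final estimate -/

theorem theorem3 (d ℓ : ℕ) (hd : 1 ≤ d) (hℓ : 2 ≤ ℓ) :
    ∃ c : ℝ, 0 < c ∧ ∀ Δ n : ℕ, d ≤ Δ → Δ ≤ n → 2 ≤ n →
      ∀ (V : Type*) [Fintype V] (G : SimpleGraph V) [DecidableRel G.Adj],
        Fintype.card V = n → G.IsDegenerate d → G.maxDegree ≤ Δ →
          ((G.vertexRankingNumber ℓ : ℝ) ≤
              c * (Δ : ℝ) ^ (((ℓ / 2 : ℕ) : ℝ) - 1 / 2) * Real.log n ^ (5 / 4 : ℝ)) ∧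
          (Odd ℓ →
            c * (Δ : ℝ) ^ (((ℓ / 2 : ℕ) : ℝ) - 1 / 2) * Real.log n ^ (5 / 4 : ℝ) =
              c * (Δ : ℝ) ^ ((ℓ : ℝ) / 2 - 1) * Real.log n ^ (5 / 4 : ℝ)) ∧
          (Even ℓ →
            c * (Δ : ℝ) ^ (((ℓ / 2 : ℕ) : ℝ) - 1 / 2) * Real.log n ^ (5 / 4 : ℝ) =
              c * (Δ : ℝ) ^ ((ℓ : ℝ) / 2 - 1 / 2) * Real.log n ^ (5 / 4 : ℝ)) ∧
          (Real.log n ≤ (Δ : ℝ) ^ (((ℓ / 2 : ℕ) : ℝ) - 1) →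
            (G.vertexRankingNumber ℓ : ℝ) ≤
              c * (Δ : ℝ) ^ (((ℓ / 2 : ℕ) : ℝ) - 1 / 2) * Real.log n) := by
  set C : ℝ := ((4 * d + 2 : ℕ) : ℝ) ^ ℓ with hC
  have hC1 : 1 ≤ C := one_le_pow₀ (by exact_mod_cast (by omega : 1 ≤ 4 * d + 2))
  -- The layers contribute 8, the recolouring `24 * C ^ 3` and the final `+ 1` at most 2. The outer
  -- factor 2 pays for replacing log n by its 5/4 power.
  refine ⟨2 * (10 + 24 * C ^ 3), by positivity, ?_⟩
  intro Δ n hdΔ hΔn hn V _ G _ hcard hdegen hmax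
  have hΔ : 1 ≤ Δ := hd.trans hdΔ
  have hΔR : (1 : ℝ) ≤ Δ := by exact_mod_cast hΔ
  have hΔ0 : (0 : ℝ) < Δ := by linarith
  have hh : 1 ≤ ℓ / 2 := by omega
  have hhR : (1 : ℝ) ≤ ((ℓ / 2 : ℕ) : ℝ) := by exact_mod_cast hh
  set P : ℝ := (Δ : ℝ) ^ (((ℓ / 2 : ℕ) : ℝ) - 1 / 2) with hP
  have hP1 : 1 ≤ P := Real.one_le_rpow hΔR (by linarith)
  have hlog2 : 1 / 2 ≤ Real.log 2 := by linarith [Real.log_two_gt_d9]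
  set y := Real.log n with hy
  have hy2 : Real.log 2 ≤ y := Real.log_le_log (by norm_num) (by exact_mod_cast hn)
  have hyhalf : 1 / 2 ≤ y := hlog2.trans hy2
  have main : (G.vertexRankingNumber ℓ : ℝ) ≤ (10 + 24 * C ^ 3) * P * y := by
    classical
    obtain ⟨L, hL1, hL2⟩ := hdegen.exists_layering
    rw [hcard] at hL1
    -- This balances about k log n layer colours against about (P²/k) log n recolouring colours.
    set k := ⌈P⌉₊ with hk
    have hPk : P ≤ k := Nat.le_ceil P
    have hk0 : 0 < k := Nat.ceil_pos.2 (by linarith)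
    have hkR : (0 : ℝ) < k := by exact_mod_cast hk0
    have hk2 : (k : ℝ) ≤ 2 * P := by linarith [Nat.ceil_lt_add_one (show 0 ≤ P by linarith)]
    set s := ⌊4 * C ^ 3 * P * (1 + y)⌋₊ with hs
    have hP2 : P * P = (Δ : ℝ) ^ (2 * (ℓ / 2) - 1) := by
      rw [hP, ← Real.rpow_add hΔ0, ← Real.rpow_natCast]
      congr 1
      rw [Nat.cast_sub (by omega)]
      push_cast
      ring
    have hPΔ : (Δ : ℝ) ^ (ℓ / 2) ≤ P * P := by
      rw [hP2]
      exact pow_le_pow_right₀ hΔR (by omega)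
    have hrank := SimpleGraph.vertexRankingNumber_le_of_layering (G := G) (L := L) (D := 4 * d) (Δ := Δ)
      (ℓ := ℓ) (t := Nat.log 2 n + 1) (k := k) (s := s) hΔ hℓ hk0
      (fun v => Nat.lt_succ_of_le (Nat.le_log_of_pow_le (by norm_num) (hL1 v)))
      (fun v => by convert hL2 v)
      (fun v => by
        refine le_trans (le_of_eq ?_) ((G.degree_le_maxDegree v).trans hmax)
        rw [← SimpleGraph.card_neighborFinset_eq_degree]
        congr 1
        ext w; simp)
      (by
        refine lt_of_le_of_lt ?_ (Nat.lt_floor_add_one _)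
        rw [hcard]
        push_cast
        have e : ((4 * (d : ℝ) + 2) ^ ℓ) = C := by rw [hC]; push_cast; rfl
        rw [e, ← hP2, ← hy]
        have h1 : 4 / (k : ℝ) * (C ^ 3 * (P * P)) ≤ 4 * C ^ 3 * P := by
          rw [div_mul_eq_mul_div, div_le_iff₀ hkR]
          have : 4 * C ^ 3 * P * P ≤ 4 * C ^ 3 * P * k := by gcongr
          linarith
        have h2 : 4 * (C ^ 2 * (Δ : ℝ) ^ (ℓ / 2)) / (k : ℝ) ≤ 4 * C ^ 3 * P := by
          rw [div_le_iff₀ hkR]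
          calc 4 * (C ^ 2 * (Δ : ℝ) ^ (ℓ / 2)) ≤ 4 * (C ^ 3 * (P * P)) := by
                gcongr
                norm_num
            _ = 4 * C ^ 3 * P * P := by ring
            _ ≤ _ := by gcongr
        calc _ ≤ 4 * C ^ 3 * P + 4 * C ^ 3 * P * y := by gcongr
          _ = _ := by ring)
    have hsle : (s : ℝ) ≤ 4 * C ^ 3 * P * (1 + y) := Nat.floor_le (by positivity)
    have ht : ((Nat.log 2 n : ℕ) : ℝ) ≤ 2 * y := by
      have h1 : (2 : ℝ) ^ Nat.log 2 n ≤ n := by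
        exact_mod_cast Nat.pow_log_le_self 2 (by omega)
      have h2 := Real.log_le_log (by positivity) h1
      rw [Real.log_pow] at h2
      have : (Nat.log 2 n : ℝ) * (1 / 2) ≤ Nat.log 2 n * Real.log 2 := by gcongr
      linarith
    have hrank' : (G.vertexRankingNumber ℓ : ℝ) ≤ (Nat.log 2 n + 1) * k + 2 * s + 1 := by
      exact_mod_cast hrank
    have h1 : ((Nat.log 2 n : ℕ) + 1 : ℝ) * k ≤ 4 * y * (2 * P) := by
      gcongr
      linarith
    have h2 : 4 * C ^ 3 * P * (1 + y) ≤ 4 * C ^ 3 * P * (3 * y) := by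
      gcongr; linarith
    have h3 : 1 ≤ 2 * (P * y) := by nlinarith
    nlinarith
  -- Since y ≥ log 2 ≥ 1/2, also y^(1/4) ≥ 1/2.
  have hy54 : y ≤ 2 * y ^ (5 / 4 : ℝ) := by
    have hy0 : 0 < y := by linarith
    have h1 : y ^ (5 / 4 : ℝ) = y * y ^ (1 / 4 : ℝ) := by
      rw [← Real.rpow_one_add' hy0.le (by norm_num)]; norm_num
    have h2 : 1 / 2 ≤ y ^ (1 / 4 : ℝ) := by
      calc (1 / 2 : ℝ) = (1 / 2 : ℝ) ^ (1 : ℝ) := by simp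
        _ ≤ (1 / 2 : ℝ) ^ (1 / 4 : ℝ) :=
            Real.rpow_le_rpow_of_exponent_ge (by norm_num) (by norm_num) (by norm_num)
        _ ≤ _ := Real.rpow_le_rpow (by norm_num) hyhalf (by norm_num)
    rw [h1]
    nlinarith
  have hK : 0 ≤ (10 + 24 * C ^ 3) * P := by positivity
  refine ⟨?_, fun hodd => ?_, fun heven => ?_, fun _ => ?_⟩
  · have := mul_le_mul_of_nonneg_left hy54 hK
    linarith
  · obtain ⟨m, rfl⟩ := hodd
    rw [hP, show (2 * m + 1) / 2 = m by omega]
    congr 3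
    push_cast
    ring
  · obtain ⟨m, rfl⟩ := heven
    rw [hP, show (m + m) / 2 = m by omega]
    congr 3
    push_cast
    ring
  · have : 0 ≤ (10 + 24 * C ^ 3) * P * y := by positivity
    linarith
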